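/- Let $X$ be a real Banach space. Then $X$ is a Hilbert space (that is, its norm is induced by an inner product) if and only if, for every two-dimensional linear subspace $Y$ of $X$, every extreme contraction $T$ in $L(Y)$ is an isometry. Here $L(Y)$ is the space of bounded linear operators $Y \to Y$ with the operator norm, and an extreme contraction in $L(Y)$ is an extreme point of the closed unit ball of $L(Y)$. -/

import Mathlib

/-- A real Banach space is a Hilbert space: its norm is induced by an inner product
(for the given real vector space structure). -/
def IsHilbertSpace (X : Type*) [NormedAddCommGroup X] [h : NormedSpace ℝ X] : Prop :=
  CompleteSpace X ∧ ∃ I : InnerProductSpace ℝ X, I.toNormedSpace = h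

/-- `T` is an extreme contraction in `L(Y)`: an extreme point of the closed unit ball of the
space of bounded linear operators on `Y` with the operator norm. -/
def IsExtremeContraction {Y : Type*} [NormedAddCommGroup Y] [NormedSpace ℝ Y]
    (T : Y →L[ℝ] Y) : Prop :=
  T ∈ Set.extremePoints ℝ (Metric.closedBall (0 : Y →L[ℝ] Y) 1)

/-! Suppose extreme contractions of planes are isometries. In a plane `Y`, fix an extreme point `e`
of the unit ball. For a unit vector `x`, the contractions sending `x` to `e` form a nonempty compact
face of the unit ball of `L(Y)`, so this face contains an extreme contraction, hence an isometry.
Thus every unit vector is moved to `e` by an isometry, and an isometry-invariant nonzero quadratic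
form must be a multiple of the squared norm. The parallelogram law therefore holds in each plane,
hence in `X`, and Jordan–von Neumann applies. Conversely, in a Euclidean plane, a contraction with a
singular value `s < 1` is the midpoint of the two contractions obtained by replacing `s` with `1`
and with `2s - 1`. -/

open MeasureTheory in
/-- A linear isometry of a finite-dimensional real normed space has determinant `±1`. -/
theorem abs_det_eq_one_of_isometry {E : Type*} [NormedAddCommGroup E] [NormedSpace ℝ E]
    [FiniteDimensional ℝ E] {T : E →ₗ[ℝ] E} (hT : ∀ x, ‖T x‖ = ‖x‖) : |LinearMap.det T| = 1 := by
  borelize E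
  have hinj : Function.Injective T := by
    rw [← LinearMap.ker_eq_bot, LinearMap.ker_eq_bot']
    intro x hx
    rw [← norm_eq_zero, ← hT, hx, norm_zero]
  have hsurj := LinearMap.injective_iff_surjective.1 hinj
  have himg : T '' Metric.ball 0 1 = Metric.ball 0 1 := by
    ext y
    constructor
    · rintro ⟨x, hx, rfl⟩
      simpa [hT] using hx
    · intro hy
      obtain ⟨x, rfl⟩ := hsurj y
      exact ⟨x, by simpa [hT] using hy, rfl⟩
  have h := Measure.addHaar_image_linearMap (Measure.addHaar : Measure E) T (Metric.ball 0 1)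
  rw [himg] at h
  have h0 : (Measure.addHaar : Measure E) (Metric.ball 0 1) ≠ 0 :=
    (Metric.measure_ball_pos _ _ one_pos).ne'
  have h1 : (Measure.addHaar : Measure E) (Metric.ball 0 1) ≠ ⊤ := measure_ball_lt_top.ne
  have h2 : ENNReal.ofReal |LinearMap.det T| = 1 := by
    rw [← ENNReal.mul_left_inj h0 h1, one_mul]
    exact h.symm
  simpa using h2

open MeasureTheory in
/-- A plane whose isometries move every unit vector to one fixed vector satisfies the
parallelogram law: the squared norm is a multiple of the isometry-invariant quadratic form
`x ↦ ∫ y in ball 0 1, det (x, y) ^ 2`. -/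
theorem innerProductSpaceable_of_transitive {E : Type*} [NormedAddCommGroup E] [NormedSpace ℝ E]
    (hE : Module.finrank ℝ E = 2) (e : E)
    (H : ∀ x : E, ‖x‖ = 1 → ∃ T : E →ₗ[ℝ] E, (∀ y, ‖T y‖ = ‖y‖) ∧ T x = e) :
    InnerProductSpaceable E := by
  have : FiniteDimensional ℝ E := FiniteDimensional.of_finrank_pos (by omega)
  borelize E
  let μ : Measure E := Measure.addHaar
  let b : Module.Basis (Fin 2) ℝ E := Module.finBasisOfFinrankEq ℝ E hE
  let D : E → E → ℝ := fun x y => b.coord 0 x * b.coord 1 y - b.coord 1 x * b.coord 0 y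
  -- The coordinate formula makes linearity and continuity in each argument plain; the determinant
  -- form shows that a linear map `T` multiplies `D` by `det T`.
  have hD : ∀ x y, D x y = b.det ![x, y] := by
    intro x y
    simp only [D, Module.Basis.det_apply, Matrix.det_fin_two, Module.Basis.toMatrix_apply,
      Module.Basis.coord_apply, Matrix.cons_val_zero, Matrix.cons_val_one]
    ring
  have hc : ∀ i, Continuous (b.coord i) := fun i => LinearMap.continuous_of_finiteDimensional _
  have hDc : ∀ x, Continuous (D x) := fun x =>
    ((continuous_const.mul (hc 1)).sub (continuous_const.mul (hc 0)))
  have hint : ∀ x, IntegrableOn (fun y => D x y ^ 2) (Metric.ball 0 1) μ := fun x =>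
    (((hDc x).pow 2).continuousOn.integrableOn_compact (isCompact_closedBall 0 1)).mono_set
      Metric.ball_subset_closedBall
  let Q : E → ℝ := fun x => ∫ y in Metric.ball 0 1, D x y ^ 2 ∂μ
  have hQsmul : ∀ (a : ℝ) x, Q (a • x) = a ^ 2 * Q x := by
    intro a x
    simp only [Q]
    rw [← integral_const_mul]
    refine integral_congr_ae (Filter.Eventually.of_forall fun y => ?_)
    simp only [D, map_smul, smul_eq_mul]
    ring
  have hQpar : ∀ x y, Q (x + y) + Q (x - y) = 2 * (Q x + Q y) := by
    intro x y
    simp only [Q]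
    rw [← integral_add (hint _) (hint _), ← integral_add (hint _) (hint _),
      ← integral_const_mul]
    refine integral_congr_ae (Filter.Eventually.of_forall fun z => ?_)
    simp only [D, map_add, map_sub]
    ring
  have hQinv : ∀ T : E →ₗ[ℝ] E, (∀ y, ‖T y‖ = ‖y‖) → ∀ x, Q (T x) = Q x := by
    intro T hT x
    have hdet := abs_det_eq_one_of_isometry hT
    have hTD : ∀ y, D (T x) (T y) ^ 2 = D x y ^ 2 := by
      intro y
      have : D (T x) (T y) = LinearMap.det T * D x y := by
        rw [hD, hD, ← b.det_comp]
        congr 1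
        ext i
        fin_cases i <;> rfl
      rw [this, mul_pow, ← sq_abs, hdet, one_pow, one_mul]
    have hmp : MeasurePreserving T μ μ := by
      refine ⟨(LinearMap.continuous_of_finiteDimensional T).measurable, ?_⟩
      rw [Measure.map_linearMap_addHaar_eq_smul_addHaar μ (by
        intro h0
        simp [h0] at hdet)]
      simp [abs_inv, hdet]
    have hiso : Isometry T := AddMonoidHomClass.isometry_of_norm T hT
    have hemb : MeasurableEmbedding T := hiso.isClosedEmbedding.measurableEmbedding
    have hpre : T ⁻¹' Metric.ball 0 1 = Metric.ball 0 1 := by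
      ext y
      simp [hT]
    simp only [Q]
    rw [← hmp.setIntegral_preimage_emb hemb, hpre]
    simp only [hTD]
  -- Transitivity enters here: `Q` takes the value `Q e` on the whole unit sphere.
  have hQ : ∀ x, Q x = Q e * (‖x‖ * ‖x‖) := by
    intro x
    rcases eq_or_ne x 0 with rfl | hx
    · have := hQsmul 0 0
      simpa using this
    · have hx' : ‖x‖ ≠ 0 := norm_ne_zero_iff.2 hx
      obtain ⟨T, hT, hTx⟩ := H (‖x‖⁻¹ • x) (by
        rw [norm_smul, norm_inv, norm_norm, inv_mul_cancel₀ hx'])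
      rw [← hTx, hQinv T hT, hQsmul]
      field_simp
  have hQpos : 0 < Q (b 0) := by
    simp only [Q]
    rw [setIntegral_pos_iff_support_of_nonneg_ae
      (Filter.Eventually.of_forall fun y => sq_nonneg _) (hint _)]
    -- The witness is `b 1` rescaled to norm `1 / 2`: it lies in the ball, and `D (b 0)` does not
    -- vanish there.
    refine IsOpen.measure_pos μ (((hDc _).pow 2).isOpen_support.inter Metric.isOpen_ball)
      ⟨(2 * ‖b 1‖)⁻¹ • b 1, ?_, ?_⟩
    · have : ‖b 1‖ ≠ 0 := norm_ne_zero_iff.2 (b.ne_zero 1)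
      simp [D, this]
    · have : ‖b 1‖ ≠ 0 := norm_ne_zero_iff.2 (b.ne_zero 1)
      rw [mem_ball_zero_iff, norm_smul, norm_inv, norm_mul, norm_norm, mul_inv, mul_assoc,
        inv_mul_cancel₀ this]
      norm_num
  have hQe : Q e ≠ 0 := by
    intro h0
    rw [hQ, h0, zero_mul] at hQpos
    exact hQpos.false
  refine ⟨fun x y => mul_left_cancel₀ hQe ?_⟩
  have := hQpar x y
  rw [hQ (x + y), hQ (x - y), hQ x, hQ y] at this
  linarith

/-- Any unit vector is mapped to any given extreme point of the unit ball by some extreme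
contraction. -/
theorem exists_isExtremeContraction_apply_eq {E : Type*} [NormedAddCommGroup E]
    [NormedSpace ℝ E] [FiniteDimensional ℝ E] {x e : E} (hx : ‖x‖ = 1)
    (he : e ∈ Set.extremePoints ℝ (Metric.closedBall (0 : E) 1)) :
    ∃ T : E →L[ℝ] E, IsExtremeContraction T ∧ T x = e := by
  have : ProperSpace (E →L[ℝ] E) := FiniteDimensional.proper ℝ _
  let F : Set (E →L[ℝ] E) := Metric.closedBall 0 1 ∩ {T | T x = e}
  have hmem : ∀ T ∈ Metric.closedBall (0 : E →L[ℝ] E) 1, T x ∈ Metric.closedBall (0 : E) 1 := by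
    intro T hT
    rw [mem_closedBall_zero_iff] at hT ⊢
    simpa [hx] using T.le_of_opNorm_le hT x
  -- If a proper convex combination of contractions sends `x` to `e`, so does each of them, because
  -- `e` is extreme.
  have hext : IsExtreme ℝ (Metric.closedBall (0 : E →L[ℝ] E) 1) F := by
    refine ⟨Set.inter_subset_left, ?_⟩
    rintro A hA B hB T ⟨-, hT⟩ ⟨s, t, hs, ht, hst, rfl⟩
    exact ⟨hA, he.2 (hmem A hA) (hmem B hB) ⟨s, t, hs, ht, hst, by simpa using hT⟩⟩
  have hcpt : IsCompact F := (isCompact_closedBall 0 1).inter_right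
    (isClosed_eq (ContinuousLinearMap.apply ℝ E x).continuous continuous_const)
  have hne : F.Nonempty := by
    -- The rank-one map `g ⊗ e`, with `g` a norming functional of `x`, lies in `F`.
    obtain ⟨g, hg, hgx⟩ := exists_dual_vector'' ℝ x
    refine ⟨g.smulRight e, ?_, by simp [hgx, hx]⟩
    have h1 := mem_closedBall_zero_iff.1 he.1
    rw [mem_closedBall_zero_iff, ContinuousLinearMap.norm_smulRight_apply]
    exact mul_le_one₀ hg (norm_nonneg _) h1
  obtain ⟨T, hT⟩ := hcpt.extremePoints_nonempty hne
  exact ⟨T, hext.extremePoints_subset_extremePoints hT, hT.1.2⟩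

theorem innerProductSpaceable_of_isExtremeContraction_isometry {E : Type*}
    [NormedAddCommGroup E] [NormedSpace ℝ E] (hE : Module.finrank ℝ E = 2)
    (H : ∀ T : E →L[ℝ] E, IsExtremeContraction T → Isometry T) : InnerProductSpaceable E := by
  have : FiniteDimensional ℝ E := FiniteDimensional.of_finrank_pos (by omega)
  have : ProperSpace E := FiniteDimensional.proper ℝ E
  obtain ⟨e, he⟩ := (isCompact_closedBall (0 : E) 1).extremePoints_nonempty ⟨0, by simp⟩
  refine innerProductSpaceable_of_transitive hE e fun x hx => ?_
  obtain ⟨T, hT, hTx⟩ := exists_isExtremeContraction_apply_eq hx he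
  exact ⟨T, (AddMonoidHomClass.isometry_iff_norm T).1 (H T hT), hTx⟩

/-- The parallelogram law involves only two vectors, so it can be checked in their span. Dependent
vectors span no plane, but for them the law follows from homogeneity of the norm. -/
theorem innerProductSpaceable_of_forall_plane {X : Type*} [NormedAddCommGroup X]
    [NormedSpace ℝ X]
    (H : ∀ Y : Submodule ℝ X, Module.finrank ℝ Y = 2 → InnerProductSpaceable Y) :
    InnerProductSpaceable X := by
  refine ⟨fun x y => ?_⟩
  by_cases hxy : LinearIndependent ℝ ![x, y]
  · have := H _ (by simpa using finrank_span_eq_card hxy)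
    have hx : x ∈ Submodule.span ℝ (Set.range ![x, y]) := Submodule.subset_span ⟨0, rfl⟩
    have hy : y ∈ Submodule.span ℝ (Set.range ![x, y]) := Submodule.subset_span ⟨1, rfl⟩
    simpa using this.parallelogram_identity ⟨x, hx⟩ ⟨y, hy⟩
  · have key : ∀ (a : ℝ) (z : X), ‖z + a • z‖ * ‖z + a • z‖ + ‖z - a • z‖ * ‖z - a • z‖ =
        2 * (‖z‖ * ‖z‖ + ‖a • z‖ * ‖a • z‖) := by
      intro a z
      have h1 : z + a • z = (1 + a) • z := by rw [add_smul, one_smul]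
      have h2 : z - a • z = (1 - a) • z := by rw [sub_smul, one_smul]
      rw [h1, h2]
      simp only [norm_smul, Real.norm_eq_abs]
      linear_combination (‖z‖ * ‖z‖) * (abs_mul_abs_self (1 + a) + abs_mul_abs_self (1 - a)
        - 2 * abs_mul_abs_self a)
    rcases eq_or_ne x 0 with rfl | hx
    · simp
      ring
    · rw [LinearIndependent.pair_iff' hx] at hxy
      push Not at hxy
      obtain ⟨a, rfl⟩ := hxy
      exact key a x

/-- In a finite-dimensional real inner product space every extreme contraction is an isometry:
otherwise some singular value `s` is smaller than `1`, and it can be moved in both directions. -/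
theorem IsExtremeContraction.isometry_of_innerProductSpace {E : Type*} [NormedAddCommGroup E]
    [InnerProductSpace ℝ E] [FiniteDimensional ℝ E] {T : E →L[ℝ] E}
    (hT : IsExtremeContraction T) : Isometry T := by
  have : CompleteSpace E := FiniteDimensional.complete ℝ E
  have hT1 : ‖T‖ ≤ 1 := mem_closedBall_zero_iff.1 hT.1
  have hTle : ∀ x, ‖T x‖ ≤ ‖x‖ := fun x => by simpa using T.le_of_opNorm_le hT1 x
  let A : E →L[ℝ] E := ContinuousLinearMap.adjoint T ∘L T
  have hA : ∀ x y, inner ℝ (A x) y = inner ℝ (T x) (T y) := fun x y => by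
    simp [A, ContinuousLinearMap.adjoint_inner_left]
  have hsymm : (A : E →ₗ[ℝ] E).IsSymmetric := by
    intro x y
    have h1 := hA x y
    have h2 := hA y x
    rw [real_inner_comm] at h2
    rw [ContinuousLinearMap.coe_coe, h1, h2, real_inner_comm]
  let v := hsymm.eigenvectorBasis rfl
  let l := hsymm.eigenvalues rfl
  have hv : ∀ i, A (v i) = l i • v i := fun i => hsymm.apply_eigenvectorBasis rfl i
  by_cases hl : ∀ i, l i = 1
  · rw [ContinuousLinearMap.isometry_iff_adjoint_comp_self]
    refine ContinuousLinearMap.coe_injective (v.toBasis.ext fun i => ?_)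
    have := hv i
    rw [hl i, one_smul] at this
    simpa [A] using this
  exfalso
  push Not at hl
  obtain ⟨i, hi⟩ := hl
  set u := v i with hu
  have hu1 : ‖u‖ = 1 := v.orthonormal.1 i
  have hlu : ‖T u‖ ^ 2 = l i := by
    rw [← real_inner_self_eq_norm_sq, ← hA, hv, inner_smul_left, real_inner_self_eq_norm_sq, hu1]
    simp
  have hs1 : ‖T u‖ < 1 := by
    refine lt_of_le_of_ne (hu1 ▸ hTle u) fun h => hi ?_
    rw [← hlu, h, one_pow]
  have horth : ∀ x, inner ℝ u x = 0 → inner ℝ (T u) (T x) = 0 := by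
    intro x hx
    rw [← hA, hv, inner_smul_left, hx, mul_zero]
  -- `f` is the left singular vector paired with `u`. If `T u = 0`, then `T` is not surjective and
  -- any unit vector orthogonal to its range serves.
  obtain ⟨f, hf1, hf, hfo⟩ : ∃ f : E, ‖f‖ = 1 ∧ T u = ‖T u‖ • f ∧
      ∀ x, inner ℝ u x = 0 → inner ℝ f (T x) = 0 := by
    by_cases h0 : T u = 0
    · have hns : ¬ Function.Surjective (T : E →ₗ[ℝ] E) := by
        rw [← LinearMap.injective_iff_surjective]
        intro hinj
        have : u = 0 := hinj (by simpa using h0)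
        simp [this] at hu1
      have hr : (LinearMap.range (T : E →ₗ[ℝ] E))ᗮ ≠ ⊥ := by
        rw [Ne, Submodule.orthogonal_eq_bot_iff, LinearMap.range_eq_top]
        exact hns
      obtain ⟨g, hg, hg0⟩ := Submodule.exists_mem_ne_zero_of_ne_bot hr
      have hg' : ‖g‖ ≠ 0 := norm_ne_zero_iff.2 hg0
      refine ⟨‖g‖⁻¹ • g, by rw [norm_smul, norm_inv, norm_norm, inv_mul_cancel₀ hg'],
        by simp [h0], fun x _ => ?_⟩
      rw [inner_smul_left, real_inner_comm,
        (Submodule.mem_orthogonal _ _).1 hg (T x) ⟨x, rfl⟩, mul_zero]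
    · have h0' : ‖T u‖ ≠ 0 := norm_ne_zero_iff.2 h0
      refine ⟨‖T u‖⁻¹ • T u, by rw [norm_smul, norm_inv, norm_norm, inv_mul_cancel₀ h0'],
        by rw [smul_smul, mul_inv_cancel₀ h0', one_smul], fun x hx => ?_⟩
      rw [inner_smul_left, horth x hx, mul_zero]
  -- Adding `c • S` changes the coefficient `‖T u‖` of `f` at `u` to `‖T u‖ + c` and leaves `T`
  -- unchanged on the complement of `u`, whose image is orthogonal to `f`.
  let S : E →L[ℝ] E := (innerSL ℝ u).smulRight f
  have hball : ∀ c : ℝ, |‖T u‖ + c| ≤ 1 → T + c • S ∈ Metric.closedBall (0 : E →L[ℝ] E) 1 := by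
    intro c hc
    rw [mem_closedBall_zero_iff]
    refine ContinuousLinearMap.opNorm_le_bound _ zero_le_one fun x => ?_
    rw [one_mul]
    let a : ℝ := inner ℝ u x
    let x' := x - a • u
    have hx' : inner ℝ u x' = 0 := by
      simp [x', a, inner_sub_right, inner_smul_right, hu1]
    have hxx : x = a • u + x' := by simp [x']
    have hval : (T + c • S) x = ((‖T u‖ + c) * a) • f + T x' := by
      have h1 : T x = a • ‖T u‖ • f + T x' := by
        rw [← hf, ← map_smul, ← map_add, ← hxx]
      simp only [add_apply, smul_apply, h1, S,
        ContinuousLinearMap.smulRight_apply, innerSL_apply_apply]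
      module
    have hn1 : ‖(T + c • S) x‖ ^ 2 = ((‖T u‖ + c) * a) ^ 2 + ‖T x'‖ ^ 2 := by
      rw [hval, norm_add_sq_real, inner_smul_left, hfo x' hx', norm_smul, hf1]
      simp [mul_pow]
    have hn2 : ‖x‖ ^ 2 = a ^ 2 + ‖x'‖ ^ 2 := by
      conv_lhs => rw [hxx]
      rw [norm_add_sq_real, inner_smul_left, hx', norm_smul, hu1]
      simp
    refine le_of_sq_le_sq ?_ (norm_nonneg _)
    rw [hn1, hn2]
    have h3 : (‖T u‖ + c) ^ 2 ≤ 1 := (sq_le_one_iff_abs_le_one _).2 hc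
    have h4 : ‖T x'‖ ^ 2 ≤ ‖x'‖ ^ 2 := pow_le_pow_left₀ (norm_nonneg _) (hTle x') 2
    have h5 := mul_le_mul_of_nonneg_right h3 (sq_nonneg a)
    rw [mul_pow]
    linarith
  have hs0 := norm_nonneg (T u)
  -- With `c = ±(1 - ‖T u‖)`, the new coefficients `1` and `2‖T u‖ - 1` both lie in `[-1, 1]`, and
  -- `T` is the midpoint.
  have heq := hT.2 (hball (1 - ‖T u‖) (by rw [abs_le]; constructor <;> linarith))
    (hball (-(1 - ‖T u‖)) (by rw [abs_le]; constructor <;> linarith))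
    ⟨1 / 2, 1 / 2, by norm_num, by norm_num, by norm_num, by module⟩
  have hSu : (1 - ‖T u‖) • S u = 0 := by
    have := congrArg (fun R : E →L[ℝ] E => R u) heq
    simpa using this
  rw [smul_eq_zero] at hSu
  rcases hSu with h | h
  · linarith
  · have hf0 : f = 0 := by simpa [S, hu1] using h
    simp [hf0] at hf1

theorem theorem2p7 (X : Type*) [NormedAddCommGroup X] [NormedSpace ℝ X] [CompleteSpace X] :
    IsHilbertSpace X ↔
      ∀ Y : Submodule ℝ X, Module.finrank ℝ Y = 2 →
        ∀ T : Y →L[ℝ] Y, IsExtremeContraction T → Isometry T := by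
  constructor
  · rintro ⟨-, I, rfl⟩ Y hY T hT
    have : FiniteDimensional ℝ Y := FiniteDimensional.of_finrank_pos (by omega)
    exact hT.isometry_of_innerProductSpace
  · intro H
    have hX : InnerProductSpaceable X := innerProductSpaceable_of_forall_plane fun Y hY =>
      innerProductSpaceable_of_isExtremeContraction_isometry hY (H Y hY)
    exact ⟨inferInstance, InnerProductSpace.ofNorm ℝ hX.parallelogram_identity, rfl⟩
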